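/- Let $m\ge 1$ be an integer. A Daubechies filter of order $m$ is a trigonometric polynomial $H_m(\omega)=2^{-1/2}\sum_{\ell=0}^{2m-1}h_m(\ell)e^{i\ell\omega}$ with real coefficients $h_m(\ell)$, normalized by $H_m(0)=1$, such that $$|H_m(\omega)|^2=\Big(\cos^2\frac{\omega}{2}\Big)^m\sum_{k=0}^{m-1}\binom{m-1+k}{k}\Big(\sin^2\frac{\omega}{2}\Big)^k\qquad(\omega\in\mathbb R).$$ For $f\in L_1(\mathbb R)$ put $\hat f(\omega)=\frac{1}{\sqrt{2\pi}}\int_{\mathbb R}f(x)e^{-i\omega x}\,dx$. A Daubechies wavelet of order $m$ is a function $\psi_m^D\in L_1(\mathbb R)$ for which there are such a filter $H_m$ and a function $\varphi_m^D\in L_1(\mathbb R)$ with $$(\varphi_m^D)^{\wedge}(\omega)=\frac{1}{\sqrt{2\pi}}\prod_{\ell=1}^{\infty}H_m(\omega 2^{-\ell}),\qquad (\psi_m^D)^{\wedge}(\omega)=e^{-i\omega/2}\,\overline{H_m\Big(\frac{\omega}{2}+\pi\Big)}\,(\varphi_m^D)^{\wedge}\Big(\frac{\omega}{2}\Big)\qquad(\omega\in\mathbb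 R).$$ Let $\psi_m^D$ be a Daubechies wavelet of order $m\ge 1$, let $p\in(1,\infty)$ and let $c>0$. Put $$D=2(2\pi)^{\frac1p-\frac12}+2^{\frac12-2m}\pi^{m+\frac12}\Big(\frac{(2m)!}{m!(m-1)!}\Big)^{1/2}+(2\pi)^{2-c\log m},$$ $$E=(2\pi)^{\frac1p-\frac12}-\Big[2^{-p(\frac12+2m)+1}\pi^{p(m-\frac12)+1}\Big(\frac{(2m)!}{m!(m-1)!}\Big)^{p/2}+(2\pi)^{2-cp\log m}+(2\pi)^{1-\frac p2}\Big]^{1/p}.$$ Then $(\psi_m^D)^{\wedge}\in L_p(\mathbb R)$ and $$E\le\|(\psi_m^D)^{\wedge}\|_p .$$ If moreover $m\ge 2$ or $p\ge 2$, then also $$\|(\psi_m^D)^{\wedge}\|_p\le D .$$ -/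

import Mathlib

open MeasureTheory

noncomputable section

namespace Daubechies

/-- The Fourier transform `(2π)^{-1/2} ∫ f(x) e^{-iωx} dx` of a function `f ∈ L₁(ℝ)`. -/
def fourier (f : ℝ → ℂ) (ω : ℝ) : ℂ :=
  ((1 / Real.sqrt (2 * Real.pi) : ℝ) : ℂ) *
    ∫ x : ℝ, f x * Complex.exp (-(Complex.I * (ω : ℂ) * (x : ℂ)))

/-- The polynomial `P_{m-1}(x) = ∑_{k=0}^{m-1} C(m-1+k, k) x^k`. -/
def P (m : ℕ) (x : ℝ) : ℝ :=
  ∑ k ∈ Finset.range m, ((m - 1 + k).choose k : ℝ) * x ^ k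

/-- The trigonometric polynomial `H(ω) = 2^{-1/2} ∑_{ℓ=0}^{2m-1} h(ℓ) e^{iℓω}`. -/
def symbol {m : ℕ} (h : Fin (2 * m) → ℝ) (ω : ℝ) : ℂ :=
  ((1 / Real.sqrt 2 : ℝ) : ℂ) *
    ∑ l : Fin (2 * m), (h l : ℂ) * Complex.exp (Complex.I * ((l : ℕ) : ℂ) * (ω : ℂ))

/-- `h` is the coefficient sequence of a Daubechies filter of order `m`. The displayed identity
only gives `|H(0)| = 1`, that is `H(0) = ±1`; the sign `+` is the usual normalization, without
which the infinite product defining the scaling function does not converge. -/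
structure IsFilter (m : ℕ) (h : Fin (2 * m) → ℝ) : Prop where
  symbol_zero : symbol h 0 = 1
  norm_sq : ∀ ω : ℝ,
    ‖symbol h ω‖ ^ 2 = (Real.cos (ω / 2) ^ 2) ^ m * P m (Real.sin (ω / 2) ^ 2)

/-- `φ` is the scaling function of the filter `h`: an integrable function with
`φ^(ω) = (2π)^{-1/2} ∏_{ℓ ≥ 1} H(ω 2^{-ℓ})`. -/
structure IsScalingFunction {m : ℕ} (h : Fin (2 * m) → ℝ) (φ : ℝ → ℂ) : Prop where
  integrable : Integrable φ
  fourier_eq : ∀ ω : ℝ, fourier φ ω =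
    ((1 / Real.sqrt (2 * Real.pi) : ℝ) : ℂ) * ∏' l : ℕ, symbol h (ω / 2 ^ (l + 1))

/-- `ψ` is a Daubechies orthonormal wavelet of order `m`: an integrable function with
`ψ^(ω) = e^{-iω/2} conj(H(ω/2 + π)) φ^(ω/2)`, where `H` is a Daubechies filter of order `m`
and `φ` is its scaling function. -/
def IsWavelet (m : ℕ) (ψ : ℝ → ℂ) : Prop :=
  Integrable ψ ∧ ∃ (h : Fin (2 * m) → ℝ) (φ : ℝ → ℂ), IsFilter m h ∧ IsScalingFunction h φ ∧
    ∀ ω : ℝ, fourier ψ ω =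
      Complex.exp (-(Complex.I * (ω : ℂ) / 2)) *
        (starRingEnd ℂ) (symbol h (ω / 2 + Real.pi)) * fourier φ (ω / 2)

/-- The number `(2m)! / (m! (m-1)!)`, for `m ≥ 1`. -/
def factorialRatio (m : ℕ) : ℝ :=
  ((2 * m).factorial : ℝ) / ((m.factorial : ℝ) * ((m - 1).factorial : ℝ))

/-- The upper constant `D`. -/
def upperD (p : ℝ) (m : ℕ) (c : ℝ) : ℝ :=
  2 * (2 * Real.pi) ^ (1 / p - 1 / 2)
    + (2 : ℝ) ^ (1 / 2 - 2 * (m : ℝ)) * Real.pi ^ ((m : ℝ) + 1 / 2)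
        * factorialRatio m ^ (1 / 2 : ℝ)
    + (2 * Real.pi) ^ (2 - c * Real.log m)

/-- The lower constant `E`. -/
def lowerE (p : ℝ) (m : ℕ) (c : ℝ) : ℝ :=
  (2 * Real.pi) ^ (1 / p - 1 / 2)
    - ((2 : ℝ) ^ (-p * (1 / 2 + 2 * (m : ℝ)) + 1) * Real.pi ^ (p * ((m : ℝ) - 1 / 2) + 1)
          * factorialRatio m ^ (p / 2)
        + (2 * Real.pi) ^ (2 - c * p * Real.log m)
        + (2 * Real.pi) ^ (1 - p / 2)) ^ (1 / p)

end Daubechies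

end

/-!
Put `G x = ‖symbol h x‖`. Up to the factor `√(2π)`, the modulus of `ψ^` at `ω` is
`G (ω / 2 + π) * Φ (ω / 2)`, where `Φ x = ∏ G (x / 2 ^ l)` over `l ≥ 1`. It is at most one, so
its `p`-th power is at most itself, and for `m ≥ 2` every `p > 1` is handled by the single integral
`∫ G (x + π) * Φ x`, which has to be shown to be at most about `4.13 π`.

The integral of `f * ∏ G (x / 2 ^ l)` over `l ≤ n` and `|x| ≤ 2 ^ n * π` is governed by the transfer
operator `(T u) (2 x) = G x * u x + G (x + π) * u (x + π)`: if a periodic `u ≥ 1` satisfies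
`T u ≤ u`, the integral is at most `∫ f * u` over one period, whatever `n` is
(`intervalIntegral_transfer_le`, `integrable_of_le_prod`). A trigonometric polynomial `majorant`
serves as `u` for all orders `m ≥ 2` at once (`transfer_majorant_le`). This works because
`G ≤ 1` everywhere and `G x ≤ |cos (x / 2) * sin x|` where `cos x ≤ 0`
(`IsFilter.norm_symbol_le`): of the two points `x` and `x + π`, one always lies in the region
where the second bound holds. The integral comes out at most `4.11 π`
(`integral_norm_symbol_mul_majorant_le`), which is more than the first term of `upperD` accounts for.
The middle term makes up for the difference: over `m ≥ 2` it is smallest at `m = 2`, where it already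
suffices (`mul_sqrt_two_pi_le`). The term with `c` is not needed for `m ≥ 2`.

For `m = 1`, Viète's product gives `|ω| * ‖ψ^ ω‖ = O(1)`, hence membership in `L_p` for `p > 1`;
the term of `upperD` with `c` is then `(2π) ^ 2`, far more than the norm for `p ≥ 2`. The lower
constant `lowerE` is never positive, because its bracket contains the `p`-th power of the term it is
subtracted from (`lowerE_nonpos`).
-/

noncomputable section

namespace Daubechies

/-! ### Bounds for the filter -/

/-- `P m` is a partial sum of the power series of `(1 - y) ^ (-m)`, whose terms are nonnegative. -/
theorem one_sub_pow_mul_P_le_one {m : ℕ} (hm : 1 ≤ m) {y : ℝ} (h0 : 0 ≤ y) (h1 : y ≤ 1) :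
    (1 - y) ^ m * P m y ≤ 1 := by
  rcases h1.lt_or_eq with h1 | rfl
  · obtain ⟨n, rfl⟩ := Nat.exists_eq_add_of_le' hm
    have hy : ‖y‖ < 1 := by rwa [Real.norm_of_nonneg h0]
    have hs := hasSum_choose_mul_geometric_of_norm_lt_one n hy
    have hle : P (n + 1) y ≤ 1 / (1 - y) ^ (n + 1) := by
      rw [← hs.tsum_eq]
      refine le_trans (le_of_eq ?_)
        (hs.summable.sum_le_tsum (Finset.range (n + 1)) fun k _ => by positivity)
      unfold P
      refine Finset.sum_congr rfl fun k _ => ?_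
      rw [Nat.add_sub_cancel, Nat.add_comm n k, Nat.choose_symm_add]
    have hpos : 0 < (1 - y) ^ (n + 1) := pow_pos (by linarith) _
    calc _ ≤ (1 - y) ^ (n + 1) * (1 / (1 - y) ^ (n + 1)) := by gcongr
      _ = 1 := by field_simp
  · rw [sub_self, zero_pow (by omega), zero_mul]
    exact zero_le_one

theorem P_half (n : ℕ) : P (n + 1) (1 / 2) = 2 ^ n := by
  induction n with
  | zero => simp [P]
  | succ n ih =>
    unfold P at ih ⊢
    simp only [Nat.add_sub_cancel] at ih ⊢
    -- Pascal's rule `C(n+1+k, k) = C(n+k, k) + C(n+k, k-1)` makes the sum occur on both sides.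
    have h2 : ∑ k ∈ Finset.range (n + 2), ((n + 1 + k).choose k : ℝ) * (1 / 2) ^ k
        = ∑ k ∈ Finset.range (n + 2), ((n + k).choose k : ℝ) * (1 / 2) ^ k
          + 1 / 2 * ∑ k ∈ Finset.range (n + 1), ((n + 1 + k).choose k : ℝ) * (1 / 2) ^ k := by
      rw [Finset.sum_range_succ' _ (n + 1), Finset.sum_range_succ' _ (n + 1), Finset.mul_sum]
      have : ∀ k, ((n + 1 + (k + 1)).choose (k + 1) : ℝ) * (1 / 2) ^ (k + 1)
          = ((n + (k + 1)).choose (k + 1) : ℝ) * (1 / 2) ^ (k + 1)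
            + 1 / 2 * (((n + 1 + k).choose k : ℝ) * (1 / 2) ^ k) := by
        intro k
        have : (n + 1 + (k + 1)).choose (k + 1)
            = (n + 1 + k).choose k + (n + (k + 1)).choose (k + 1) := by
          rw [show n + 1 + (k + 1) = (n + 1 + k) + 1 by ring, Nat.choose_succ_succ,
            show n + 1 + k = n + (k + 1) by ring]
        rw [this]
        push_cast
        ring
      rw [Finset.sum_congr rfl fun k _ => this k, Finset.sum_add_distrib]
      simp
      ring
    have h3 : ((n + 1 + (n + 1)).choose (n + 1) : ℝ) = 2 * ((n + (n + 1)).choose (n + 1) : ℝ) := by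
      have h4 : (n + 1 + (n + 1)).choose (n + 1)
          = (n + (n + 1)).choose n + (n + (n + 1)).choose (n + 1) := by
        rw [show n + 1 + (n + 1) = (n + (n + 1)) + 1 by ring, Nat.choose_succ_succ]
      have h5 : (n + (n + 1)).choose n = (n + (n + 1)).choose (n + 1) := Nat.choose_symm_add
      rw [h4, h5]
      push_cast
      ring
    rw [Finset.sum_range_succ _ (n + 1)] at h2 ⊢
    rw [Finset.sum_range_succ (fun k => ((n + k).choose k : ℝ) * (1 / 2) ^ k), ih, h3] at h2
    rw [h3]
    linear_combination 2 * h2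

/-- The function `P m y / y ^ (m - 1)` is nonincreasing in `y > 0`, and its value at
`y = 1 / 2` is `4 ^ (m - 1)`. -/
theorem P_le_pow {m : ℕ} (hm : 1 ≤ m) {y : ℝ} (hy : 1 / 2 ≤ y) : P m y ≤ (4 * y) ^ (m - 1) := by
  obtain ⟨n, rfl⟩ := Nat.exists_eq_add_of_le' hm
  have h : P (n + 1) y ≤ (2 * y) ^ n * P (n + 1) (1 / 2) := by
    unfold P
    rw [Finset.mul_sum]
    refine Finset.sum_le_sum fun k hk => ?_
    have hk' : k ≤ n := Nat.lt_succ_iff.mp (Finset.mem_range.mp hk)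
    calc ((n + 1 - 1 + k).choose k : ℝ) * y ^ k
        = ((n + 1 - 1 + k).choose k : ℝ) * ((2 * y) ^ k * (1 / 2) ^ k) := by
          rw [← mul_pow]; ring_nf
      _ ≤ ((n + 1 - 1 + k).choose k : ℝ) * ((2 * y) ^ n * (1 / 2) ^ k) := by
          gcongr
          linarith
      _ = _ := by ring
  rw [P_half, ← mul_pow] at h
  rw [Nat.add_sub_cancel]
  convert h using 2
  ring

/-! ### Regularity of the filter and of the Fourier transforms -/

theorem continuous_symbol {m : ℕ} (h : Fin (2 * m) → ℝ) : Continuous (symbol h) := by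
  unfold symbol
  fun_prop

theorem symbol_add_two_pi {m : ℕ} (h : Fin (2 * m) → ℝ) (x : ℝ) :
    symbol h (x + 2 * Real.pi) = symbol h x := by
  unfold symbol
  congr 1
  refine Finset.sum_congr rfl fun l _ => ?_
  congr 1
  rw [Complex.exp_eq_exp_iff_exists_int]
  refine ⟨(l : ℕ), ?_⟩
  push_cast
  ring

theorem IsFilter.norm_symbol_le_one {m : ℕ} (hm : 1 ≤ m) {h : Fin (2 * m) → ℝ}
    (hh : IsFilter m h) (x : ℝ) : ‖symbol h x‖ ≤ 1 := by
  have h1 := one_sub_pow_mul_P_le_one hm (sq_nonneg (Real.sin (x / 2))) (Real.sin_sq_le_one _)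
  rw [← Real.cos_sq', ← hh.norm_sq] at h1
  exact (sq_le_one_iff₀ (norm_nonneg _)).mp h1

/-- On the half of the circle where `cos x ≤ 0`, all filters of order at least two obey one bound:
there `P m y ≤ (4 y) ^ (m - 1)` with `y = sin² (x / 2)`, and `4 y (1 - y) = sin² x ≤ 1`. -/
theorem IsFilter.norm_symbol_le {m : ℕ} (hm : 2 ≤ m) {h : Fin (2 * m) → ℝ}
    (hh : IsFilter m h) {x : ℝ} (hx : Real.cos x ≤ 0) :
    ‖symbol h x‖ ≤ |Real.cos (x / 2) * Real.sin x| := by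
  obtain ⟨n, rfl⟩ := Nat.exists_eq_add_of_le' hm
  rw [← abs_of_nonneg (norm_nonneg (symbol h x)), ← sq_le_sq, hh.norm_sq]
  have hx2 : x = 2 * (x / 2) := by ring
  have hsin : Real.sin x = 2 * Real.sin (x / 2) * Real.cos (x / 2) := by
    rw [← Real.sin_two_mul, ← hx2]
  have hcos : Real.cos x = 1 - 2 * Real.sin (x / 2) ^ 2 := by
    rw [← Real.cos_two_mul_eq_one_sub, ← hx2]
  have hP := P_le_pow (m := n + 2) (by omega) (y := Real.sin (x / 2) ^ 2) (by linarith)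
  have hs1 : Real.sin x ^ 2 ≤ 1 := Real.sin_sq_le_one x
  calc (Real.cos (x / 2) ^ 2) ^ (n + 2) * P (n + 2) (Real.sin (x / 2) ^ 2)
      ≤ (Real.cos (x / 2) ^ 2) ^ (n + 2) * (4 * Real.sin (x / 2) ^ 2) ^ (n + 1) := by
        gcongr
        exact hP
    _ = Real.cos (x / 2) ^ 2 * (Real.sin x ^ 2) * (Real.sin x ^ 2) ^ n := by
        rw [hsin]; ring
    _ ≤ Real.cos (x / 2) ^ 2 * (Real.sin x ^ 2) * 1 := by
        gcongr
        exact pow_le_one₀ (sq_nonneg _) hs1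
    _ = _ := by ring

theorem norm_symbol_sub_symbol_zero_le {m : ℕ} (h : Fin (2 * m) → ℝ) :
    ∃ C : ℝ, ∀ x, ‖symbol h x - symbol h 0‖ ≤ C * |x| := by
  refine ⟨1 / Real.sqrt 2 * ∑ l : Fin (2 * m), |h l| * (l : ℕ), fun x => ?_⟩
  unfold symbol
  rw [← mul_sub, ← Finset.sum_sub_distrib, norm_mul, Complex.norm_of_nonneg (by positivity),
    mul_assoc, Finset.sum_mul]
  refine mul_le_mul_of_nonneg_left ?_ (by positivity)
  refine (norm_sum_le _ _).trans (Finset.sum_le_sum fun l _ => ?_)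
  rw [← mul_sub, norm_mul, Complex.norm_real, Real.norm_eq_abs, mul_assoc |h l|]
  refine mul_le_mul_of_nonneg_left ?_ (abs_nonneg _)
  have := Real.norm_exp_I_mul_ofReal_sub_one_le (x := (l : ℕ) * x)
  simpa [mul_assoc, abs_mul] using this

theorem IsFilter.multipliable {m : ℕ} {h : Fin (2 * m) → ℝ} (hh : IsFilter m h) (x : ℝ) :
    Multipliable fun l : ℕ => symbol h (x / 2 ^ (l + 1)) := by
  obtain ⟨C, hC⟩ := norm_symbol_sub_symbol_zero_le h
  have hs : Summable fun l : ℕ => ‖symbol h (x / 2 ^ (l + 1)) - 1‖ := by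
    refine Summable.of_nonneg_of_le (fun _ => norm_nonneg _)
      (g := fun l => ‖symbol h (x / 2 ^ (l + 1)) - 1‖)
      (f := fun l => C * |x| / 2 * (1 / 2) ^ l) (fun l => ?_) (summable_geometric_two.mul_left _)
    have h1 := hC (x / 2 ^ (l + 1))
    rw [hh.symbol_zero, abs_div, abs_of_pos (by positivity : (0 : ℝ) < 2 ^ (l + 1))] at h1
    refine h1.trans_eq ?_
    rw [pow_succ, one_div, inv_pow]
    field_simp
  simpa using multipliable_one_add_of_summable hs

/-- As the factors have modulus at most one, each partial product bounds the infinite product. -/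
theorem IsScalingFunction.norm_fourier_le {m : ℕ} (hm : 1 ≤ m) {h : Fin (2 * m) → ℝ}
    (hh : IsFilter m h) {φ : ℝ → ℂ} (hφ : IsScalingFunction h φ) (x : ℝ) (n : ℕ) :
    ‖fourier φ x‖ ≤
      1 / Real.sqrt (2 * Real.pi) * ∏ l ∈ Finset.range n, ‖symbol h (x / 2 ^ (l + 1))‖ := by
  rw [hφ.fourier_eq, norm_mul, Complex.norm_of_nonneg (by positivity)]
  gcongr
  have ht := (hh.multipliable x).hasProd.tendsto_prod_nat.norm
  refine le_of_tendsto ht (Filter.eventually_atTop.mpr ⟨n, fun k hk => ?_⟩)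
  rw [norm_prod]
  exact Finset.prod_le_prod_of_subset_of_le_one (Finset.range_mono hk)
    (fun _ _ => norm_nonneg _) fun _ _ _ => hh.norm_symbol_le_one hm _

theorem continuous_fourier {f : ℝ → ℂ} (hf : Integrable f) : Continuous (fourier f) := by
  unfold fourier
  refine continuous_const.mul ?_
  refine continuous_of_dominated (bound := fun x => ‖f x‖) (fun ω => ?_) (fun ω => ?_) hf.norm ?_
  · exact hf.aestronglyMeasurable.mul (by fun_prop)
  · refine Filter.Eventually.of_forall fun x => ?_
    rw [norm_mul, Complex.norm_exp]
    simp
  · refine Filter.Eventually.of_forall fun x => ?_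
    fun_prop

/-! ### Integrals of infinite products through the transfer operator -/

theorem periodic_mul_prod {G f : ℝ → ℝ} {T : ℝ} (hG : Function.Periodic G T)
    (hf : Function.Periodic f T) (n : ℕ) :
    Function.Periodic (fun x => f x * ∏ l ∈ Finset.range n, G (x / 2 ^ (l + 1))) (2 ^ n * T) := by
  intro x
  refine congrArg₂ (· * ·) ?_ ?_
  · have := hf.nat_mul (2 ^ n) x
    rwa [Nat.cast_pow, Nat.cast_ofNat] at this
  · refine Finset.prod_congr rfl fun l hl => ?_
    have h1 := hG.nat_mul (2 ^ (n - (l + 1))) (x / 2 ^ (l + 1))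
    have h2 : (2 : ℝ) ^ n = 2 ^ (n - (l + 1)) * 2 ^ (l + 1) := by
      rw [← pow_add, Nat.sub_add_cancel (Finset.mem_range.mp hl)]
    rw [← h1, h2]
    congr 1
    push_cast
    field_simp

/-- If `u` is a supersolution of the transfer operator of `G`, then the integral of
`f x * G (x / 2) * ⋯ * G (x / 2 ^ n) * u (x / 2 ^ n)` over a period does not increase with `n`:
folding the period `2 ^ (n + 1) * (2 π)` in half only affects the last factor and `u`. -/
theorem intervalIntegral_transfer_le {G f u : ℝ → ℝ}
    (hGc : Continuous G) (hG0 : ∀ x, 0 ≤ G x) (hGp : Function.Periodic G (2 * Real.pi))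
    (hfc : Continuous f) (hf0 : ∀ x, 0 ≤ f x) (hfp : Function.Periodic f (2 * Real.pi))
    (huc : Continuous u)
    (hT : ∀ x, G x * u x + G (x + Real.pi) * u (x + Real.pi) ≤ u (2 * x)) (n : ℕ) :
    ∫ x in (0 : ℝ)..2 ^ n * (2 * Real.pi),
        f x * (∏ l ∈ Finset.range n, G (x / 2 ^ (l + 1))) * u (x / 2 ^ n)
      ≤ ∫ x in (0 : ℝ)..2 * Real.pi, f x * u x := by
  induction n with
  | zero => simp
  | succ n ih =>
    refine le_trans ?_ ih
    set a : ℝ := 2 ^ n * (2 * Real.pi) with ha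
    have ha0 : 0 ≤ a := by positivity
    set F : ℝ → ℝ := fun x => f x * ∏ l ∈ Finset.range n, G (x / 2 ^ (l + 1)) with hF
    have hFc : Continuous F := by fun_prop
    have hF0 : ∀ x, 0 ≤ F x := fun x => mul_nonneg (hf0 x) (Finset.prod_nonneg fun _ _ => hG0 _)
    -- All factors but the last have period `2 ^ n * (2 π)`.
    have hFp : ∀ x, F (x + a) = F x := periodic_mul_prod hGp hfp n
    set g : ℝ → ℝ := fun x => G (x / 2 ^ (n + 1)) * u (x / 2 ^ (n + 1)) with hg
    have hgc : Continuous g := by fun_prop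
    have hFg : Continuous fun x => F x * g x := hFc.mul hgc
    calc ∫ x in (0 : ℝ)..2 ^ (n + 1) * (2 * Real.pi),
          f x * (∏ l ∈ Finset.range (n + 1), G (x / 2 ^ (l + 1))) * u (x / 2 ^ (n + 1))
        = ∫ x in (0 : ℝ)..a + a, F x * g x := by
          rw [show (2 : ℝ) ^ (n + 1) * (2 * Real.pi) = a + a by rw [ha]; ring]
          congr 1
          funext x
          rw [Finset.prod_range_succ]
          simp only [hF, hg]
          ring
      _ = (∫ x in (0 : ℝ)..a, F x * g x) + ∫ x in (0 : ℝ)..a, F (x + a) * g (x + a) := by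
          rw [intervalIntegral.integral_comp_add_right (fun x => F x * g x), zero_add]
          exact (intervalIntegral.integral_add_adjacent_intervals (hFg.intervalIntegrable _ _)
            (hFg.intervalIntegrable _ _)).symm
      _ = ∫ x in (0 : ℝ)..a, F x * (g x + g (x + a)) := by
          rw [← intervalIntegral.integral_add (hFg.intervalIntegrable _ _)
            ((by fun_prop : Continuous fun x => F (x + a) * g (x + a)).intervalIntegrable _ _)]
          congr 1
          funext x
          rw [hFp, mul_add]
      _ ≤ ∫ x in (0 : ℝ)..a, F x * u (x / 2 ^ n) := by
          refine intervalIntegral.integral_mono_on ha0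
            ((by fun_prop : Continuous fun x => F x * (g x + g (x + a))).intervalIntegrable _ _)
            ((by fun_prop : Continuous fun x => F x * u (x / 2 ^ n)).intervalIntegrable _ _)
            fun x _ => mul_le_mul_of_nonneg_left ?_ (hF0 x)
          have h1 := hT (x / 2 ^ (n + 1))
          have h2 : x / 2 ^ (n + 1) + Real.pi = (x + a) / 2 ^ (n + 1) := by
            rw [ha, pow_succ]; field_simp
          have h3 : 2 * (x / 2 ^ (n + 1)) = x / 2 ^ n := by
            rw [pow_succ]; field_simp
          rwa [h2, h3] at h1

/-- A function `Φ` dominated by all the products `G (x / 2) * ⋯ * G (x / 2 ^ n)` is integrable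
against `f`, with a bound by one integral over a period. -/
theorem integrable_of_le_prod {G f u Φ : ℝ → ℝ}
    (hGc : Continuous G) (hG0 : ∀ x, 0 ≤ G x) (hGp : Function.Periodic G (2 * Real.pi))
    (hfc : Continuous f) (hf0 : ∀ x, 0 ≤ f x) (hfp : Function.Periodic f (2 * Real.pi))
    (huc : Continuous u) (hu1 : ∀ x, 1 ≤ u x) (hup : Function.Periodic u (2 * Real.pi))
    (hT : ∀ x, G x * u x + G (x + Real.pi) * u (x + Real.pi) ≤ u (2 * x))
    (hΦc : Continuous Φ) (hΦ0 : ∀ x, 0 ≤ Φ x)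
    (hΦ : ∀ x n, Φ x ≤ ∏ l ∈ Finset.range n, G (x / 2 ^ (l + 1))) :
    Integrable (fun x => f x * Φ x) ∧
      ∫ x, f x * Φ x ≤ ∫ x in (0 : ℝ)..2 * Real.pi, f x * u x := by
  have hc : Continuous fun x => f x * Φ x := hfc.mul hΦc
  set r : ℕ → ℝ := fun n => 2 ^ n * Real.pi with hr
  have hr0 : ∀ n, 0 ≤ r n := fun n => by positivity
  have hrt : Filter.Tendsto r Filter.atTop Filter.atTop :=
    (tendsto_pow_atTop_atTop_of_one_lt one_lt_two).atTop_mul_const Real.pi_pos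
  have hbound : ∀ n, ∫ x in -r n..r n, f x * Φ x ≤ ∫ x in (0 : ℝ)..2 * Real.pi, f x * u x := by
    intro n
    refine le_trans ?_ (intervalIntegral_transfer_le hGc hG0 hGp hfc hf0 hfp huc hT n)
    set Q : ℝ → ℝ := fun x =>
      f x * (∏ l ∈ Finset.range n, G (x / 2 ^ (l + 1))) * u (x / 2 ^ n) with hQ
    have hQc : Continuous Q := by fun_prop
    have hQp : Function.Periodic Q (2 ^ n * (2 * Real.pi)) := by
      intro x
      have h1 := periodic_mul_prod hGp hfp n x
      simp only [hQ]
      congr 1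
      · rw [← hup (x / 2 ^ n)]
        congr 1
        field_simp
    have h1 := hQp.intervalIntegral_add_eq (-r n) 0
    rw [show -r n + 2 ^ n * (2 * Real.pi) = r n by simp only [hr]; ring, zero_add] at h1
    rw [← h1]
    refine intervalIntegral.integral_mono_on (by linarith [hr0 n]) (hc.intervalIntegrable _ _)
      (hQc.intervalIntegrable _ _) fun x _ => ?_
    simp only [hQ]
    have h2 : 0 ≤ f x * ∏ l ∈ Finset.range n, G (x / 2 ^ (l + 1)) :=
      mul_nonneg (hf0 x) (Finset.prod_nonneg fun _ _ => hG0 _)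
    calc f x * Φ x ≤ f x * ∏ l ∈ Finset.range n, G (x / 2 ^ (l + 1)) :=
          mul_le_mul_of_nonneg_left (hΦ x n) (hf0 x)
      _ ≤ _ := le_mul_of_one_le_right h2 (hu1 _)
  have hint : Integrable fun x => f x * Φ x := by
    refine integrable_of_intervalIntegral_norm_bounded (∫ x in (0 : ℝ)..2 * Real.pi, f x * u x)
      (a := fun n => -r n) (b := r)
      (fun n => (hc.integrableOn_Icc).mono_set Set.Ioc_subset_Icc_self)
      (Filter.tendsto_neg_atTop_atBot.comp hrt) hrt (Filter.Eventually.of_forall fun n => ?_)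
    refine le_trans (le_of_eq ?_) (hbound n)
    congr 1
    funext x
    exact Real.norm_of_nonneg (mul_nonneg (hf0 x) (hΦ0 x))
  exact ⟨hint, le_of_tendsto (intervalIntegral_tendsto_integral hint
    (Filter.tendsto_neg_atTop_atBot.comp hrt) hrt) (Filter.Eventually.of_forall hbound)⟩

/-! ### A supersolution for all orders at least two -/

/-- A supersolution `u ≥ 1` of the transfer operator of `‖symbol h ·‖`, for every filter `h` of order
at least two, namely `u x = 1 + 14/5 y + 2/5 y ^ 3` with `y = sin² (x / 2)`. The exponent `3` and
the coefficients are chosen to keep the integral over a period against `‖symbol h (· + π)‖` small;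
`14/5 = 2 + 2 · 2/5` makes the supersolution inequality sharp to leading order at `x = 0`. -/
def majorant (x : ℝ) : ℝ :=
  1 + 14 / 5 * Real.sin (x / 2) ^ 2 + 2 / 5 * (Real.sin (x / 2) ^ 2) ^ 3

/-- The supersolution inequality for `majorant`, divided by `sin²`, in terms of the cosine `c` of the
half angle. -/
theorem majorant_poly_nonneg {c : ℝ} (h1 : 1 / 2 ≤ c ^ 2) (h2 : c ≤ 1) (h0 : 0 ≤ c) :
    0 ≤ 14 / 5 * (4 * c ^ 2 - 1) + 2 / 5 * ((4 * c ^ 2) ^ 3 - 1) * (1 - c ^ 2) ^ 2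
      - 2 * c * (1 + 14 / 5 * c ^ 2 + 2 / 5 * c ^ 6) := by
  -- `12 / 17` is slightly below `1 / √2`, the true left end of the range of `c`.
  have hc : 12 / 17 ≤ c := by nlinarith
  obtain ⟨p, hp⟩ : ∃ p, p = 1 - c := ⟨_, rfl⟩
  obtain ⟨q, hq⟩ : ∃ q, q = 5 - 17 * p := ⟨_, rfl⟩
  have hp0 : 0 ≤ p := by linarith
  have hq0 : 0 ≤ q := by linarith
  -- Up to the factor `5 ^ 10`, the polynomial is `p` times a polynomial of degree nine in `p`, whose
  -- Bernstein coefficients on the interval `0 ≤ p ≤ 5 / 17` are all positive.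
  have key : (0 : ℝ) ≤ p * (10*q^9 + 3490*p*q^8 + 285400*p^2*q^7 + 11190690*p^3*q^6
      + 252690540*p^4*q^5 + 3489763770*p^5*q^4 + 29347562780*p^6*q^3 + 139496885850*p^7*q^2
      + 295941260230*p^8*q + 52190107480*p^9) := by positivity
  have hcp : c = 1 - p := by linarith
  rw [hq] at key
  rw [hcp]
  refine (mul_nonneg_iff_of_pos_left (c := (5 : ℝ) ^ 10) (by positivity)).mp (key.trans_eq ?_)
  ring

theorem majorant_ineq {A r : ℝ} (hr0 : 0 ≤ r) (hA : 0 ≤ A) (hAB : A + r ^ 2 = 1)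
    (hle : A ≤ r ^ 2) :
    (1 + 14 / 5 * A + 2 / 5 * A ^ 3)
        + 2 * A * r * (1 + 14 / 5 * r ^ 2 + 2 / 5 * (r ^ 2) ^ 3)
      ≤ 1 + 14 / 5 * (4 * A * r ^ 2) + 2 / 5 * (4 * A * r ^ 2) ^ 3 := by
  have h := mul_nonneg hA
    (majorant_poly_nonneg (c := r) (by linarith) (by nlinarith) hr0)
  obtain rfl : A = 1 - r ^ 2 := by linarith
  nlinarith [h]

theorem transfer_majorant_le {m : ℕ} (hm : 2 ≤ m) {h : Fin (2 * m) → ℝ}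
    (hh : IsFilter m h) (x : ℝ) :
    ‖symbol h x‖ * majorant x + ‖symbol h (x + Real.pi)‖ * majorant (x + Real.pi)
      ≤ majorant (2 * x) := by
  have hx2 : x = 2 * (x / 2) := by ring
  have hsin : Real.sin x = 2 * Real.sin (x / 2) * Real.cos (x / 2) := by
    rw [← Real.sin_two_mul, ← hx2]
  have hcos : Real.cos x = 1 - 2 * Real.sin (x / 2) ^ 2 := by
    rw [← Real.cos_two_mul_eq_one_sub, ← hx2]
  have hsc := Real.sin_sq_add_cos_sq (x / 2)
  have hshift : (x + Real.pi) / 2 = x / 2 + Real.pi / 2 := by ring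
  have hdbl : 2 * x / 2 = x := by ring
  have hn1 := hh.norm_symbol_le_one (by omega) x
  have hn2 := hh.norm_symbol_le_one (by omega) (x + Real.pi)
  unfold majorant
  rw [hshift, Real.sin_add_pi_div_two, hdbl, hsin]
  rcases le_total 0 (Real.cos x) with hc | hc
  · have hb := hh.norm_symbol_le hm (x := x + Real.pi) (by rw [Real.cos_add_pi]; linarith)
    rw [hshift, Real.cos_add_pi_div_two, Real.sin_add_pi, neg_mul_neg, hsin,
      show Real.sin (x / 2) * (2 * Real.sin (x / 2) * Real.cos (x / 2))
        = 2 * Real.sin (x / 2) ^ 2 * Real.cos (x / 2) by ring, abs_mul,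
      abs_of_nonneg (by positivity : 0 ≤ 2 * Real.sin (x / 2) ^ 2)] at hb
    have hi := majorant_ineq (abs_nonneg (Real.cos (x / 2))) (sq_nonneg (Real.sin (x / 2)))
      (by rw [sq_abs]; exact hsc) (by rw [sq_abs]; linarith)
    rw [sq_abs] at hi
    calc _ ≤ 1 * (1 + 14 / 5 * Real.sin (x / 2) ^ 2 + 2 / 5 * (Real.sin (x / 2) ^ 2) ^ 3)
          + 2 * Real.sin (x / 2) ^ 2 * |Real.cos (x / 2)| *
            (1 + 14 / 5 * Real.cos (x / 2) ^ 2 + 2 / 5 * (Real.cos (x / 2) ^ 2) ^ 3) := by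
          gcongr
      _ ≤ 1 + 14 / 5 * (4 * Real.sin (x / 2) ^ 2 * Real.cos (x / 2) ^ 2)
          + 2 / 5 * (4 * Real.sin (x / 2) ^ 2 * Real.cos (x / 2) ^ 2) ^ 3 := by
          rw [one_mul]; exact hi
      _ = _ := by ring
  · have hb := hh.norm_symbol_le hm hc
    rw [hsin, show Real.cos (x / 2) * (2 * Real.sin (x / 2) * Real.cos (x / 2))
        = 2 * Real.cos (x / 2) ^ 2 * Real.sin (x / 2) by ring, abs_mul,
      abs_of_nonneg (by positivity : 0 ≤ 2 * Real.cos (x / 2) ^ 2)] at hb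
    have hi := majorant_ineq (abs_nonneg (Real.sin (x / 2))) (sq_nonneg (Real.cos (x / 2)))
      (by rw [sq_abs]; linarith) (by rw [sq_abs]; linarith)
    rw [sq_abs] at hi
    calc _ ≤ 2 * Real.cos (x / 2) ^ 2 * |Real.sin (x / 2)| *
            (1 + 14 / 5 * Real.sin (x / 2) ^ 2 + 2 / 5 * (Real.sin (x / 2) ^ 2) ^ 3)
          + 1 * (1 + 14 / 5 * Real.cos (x / 2) ^ 2 + 2 / 5 * (Real.cos (x / 2) ^ 2) ^ 3) := by
          gcongr
      _ ≤ 1 + 14 / 5 * (4 * Real.cos (x / 2) ^ 2 * Real.sin (x / 2) ^ 2)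
          + 2 / 5 * (4 * Real.cos (x / 2) ^ 2 * Real.sin (x / 2) ^ 2) ^ 3 := by
          rw [one_mul, add_comm]; exact hi
      _ = _ := by ring

theorem continuous_majorant : Continuous majorant := by
  unfold majorant
  fun_prop

theorem one_le_majorant (x : ℝ) : 1 ≤ majorant x := by
  unfold majorant
  have : 0 ≤ 14 / 5 * Real.sin (x / 2) ^ 2 + 2 / 5 * (Real.sin (x / 2) ^ 2) ^ 3 := by positivity
  linarith

theorem majorant_add_two_pi (x : ℝ) : majorant (x + 2 * Real.pi) = majorant x := by
  unfold majorant
  rw [show (x + 2 * Real.pi) / 2 = x / 2 + Real.pi by ring, Real.sin_add_pi, neg_sq]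

/-! ### The integral of the supersolution -/

theorem hasDerivAt_sin_half (x : ℝ) :
    HasDerivAt (fun x : ℝ => Real.sin (x / 2)) (Real.cos (x / 2) * (1 / 2)) x :=
  ((hasDerivAt_id x).div_const 2).sin

/-- A primitive of `2 sin² (x / 2) cos (x / 2) * majorant x`, which up to sign bounds the integrand
`‖symbol h (x + π)‖ * majorant x` near the ends `0` and `2 π` of the period. -/
def edgePrimitive (x : ℝ) : ℝ :=
  4 * (1 / 3 * Real.sin (x / 2) ^ 3 + 14 / 25 * Real.sin (x / 2) ^ 5
    + 2 / 45 * Real.sin (x / 2) ^ 9)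

theorem hasDerivAt_edgePrimitive (x : ℝ) :
    HasDerivAt edgePrimitive (2 * Real.sin (x / 2) ^ 2 * Real.cos (x / 2) * majorant x) x := by
  have hs := hasDerivAt_sin_half x
  refine (((((hs.pow 3).const_mul (1 / 3)).add ((hs.pow 5).const_mul (14 / 25))).add
    ((hs.pow 9).const_mul (2 / 45))).const_mul 4).congr_deriv ?_
  unfold majorant
  push_cast
  ring

theorem majorant_eq_cos (x : ℝ) :
    majorant x = 1 + 7 / 5 * (1 - Real.cos x) + 1 / 20 * (1 - Real.cos x) ^ 3 := by
  have hcos : Real.cos x = 1 - 2 * Real.sin (x / 2) ^ 2 := by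
    rw [← Real.cos_two_mul_eq_one_sub, mul_div_cancel₀ x two_ne_zero]
  rw [hcos, majorant]
  ring

theorem integral_majorant :
    ∫ x in (Real.pi / 2)..(3 * Real.pi / 2), majorant x = 101 / 40 * Real.pi + 19 / 6 := by
  have hd : ∀ x, HasDerivAt (fun x : ℝ => 49 / 20 * x - 31 / 20 * Real.sin x
      + 3 / 40 * (x + Real.sin x * Real.cos x) - 1 / 20 * (Real.sin x - 1 / 3 * Real.sin x ^ 3))
      (majorant x) x := by
    intro x
    have hs := Real.hasDerivAt_sin x
    have hc := Real.hasDerivAt_cos x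
    refine (((((hasDerivAt_id x).const_mul (49 / 20)).sub (hs.const_mul (31 / 20))).add
      (((hasDerivAt_id x).add (hs.mul hc)).const_mul (3 / 40))).sub
      ((hs.sub ((hs.pow 3).const_mul (1 / 3))).const_mul (1 / 20))).congr_deriv ?_
    rw [majorant_eq_cos]
    have := Real.sin_sq x
    push_cast
    linear_combination (1 / 20 * Real.cos x - 3 / 40) * this
  have h32 : 3 * Real.pi / 2 = Real.pi / 2 + Real.pi := by ring
  rw [intervalIntegral.integral_eq_sub_of_hasDerivAt (fun x _ => hd x)
    (continuous_majorant.intervalIntegrable _ _), h32, Real.sin_add_pi, Real.cos_add_pi,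
    Real.sin_pi_div_two, Real.cos_pi_div_two]
  ring

theorem edgePrimitive_le {x : ℝ} (hx : Real.sin (x / 2) = Real.sqrt 2 / 2) :
    edgePrimitive x ≤ 22 / 25 := by
  have h2 : Real.sqrt 2 ^ 2 = 2 := Real.sq_sqrt (by norm_num)
  have hlt : Real.sqrt 2 < 1.4143 := by
    rw [Real.sqrt_lt' (by norm_num)]
    norm_num
  have h3 : Real.sin (x / 2) ^ 3 = Real.sqrt 2 / 4 := by
    rw [hx]; linear_combination Real.sqrt 2 / 8 * h2
  have h5 : Real.sin (x / 2) ^ 5 = Real.sqrt 2 / 8 := by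
    rw [show Real.sin (x / 2) ^ 5 = Real.sin (x / 2) ^ 3 * Real.sin (x / 2) ^ 2 by ring, h3, hx]
    linear_combination Real.sqrt 2 / 16 * h2
  have h9 : Real.sin (x / 2) ^ 9 = Real.sqrt 2 / 32 := by
    rw [show Real.sin (x / 2) ^ 9 = (Real.sin (x / 2) ^ 3) ^ 3 by ring, h3]
    linear_combination Real.sqrt 2 / 64 * h2
  rw [edgePrimitive, h3, h5, h9]
  linarith

theorem integral_norm_symbol_mul_majorant_le {m : ℕ} (hm : 2 ≤ m) {h : Fin (2 * m) → ℝ}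
    (hh : IsFilter m h) :
    ∫ x in (0 : ℝ)..2 * Real.pi, ‖symbol h (x + Real.pi)‖ * majorant x ≤ 411 / 100 * Real.pi := by
  have hpi := Real.pi_pos
  have hu0 : ∀ x, 0 ≤ majorant x := fun x => zero_le_one.trans (one_le_majorant x)
  have hmc := continuous_majorant
  have hc : Continuous fun x => ‖symbol h (x + Real.pi)‖ * majorant x :=
    ((continuous_symbol h).comp (by fun_prop)).norm.mul hmc
  have hi : ∀ a b, IntervalIntegrable (fun x => ‖symbol h (x + Real.pi)‖ * majorant x) volume a b :=
    fun a b => hc.intervalIntegrable a b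
  have hgc : Continuous fun x => 2 * Real.sin (x / 2) ^ 2 * Real.cos (x / 2) * majorant x := by
    fun_prop
  have hedge : ∀ x, 0 ≤ Real.cos x → ‖symbol h (x + Real.pi)‖ * majorant x
      ≤ 2 * Real.sin (x / 2) ^ 2 * |Real.cos (x / 2)| * majorant x := by
    intro x hx
    refine mul_le_mul_of_nonneg_right ?_ (hu0 x)
    have hb := hh.norm_symbol_le hm (x := x + Real.pi) (by rw [Real.cos_add_pi]; linarith)
    have hsin : Real.sin x = 2 * Real.sin (x / 2) * Real.cos (x / 2) := by
      rw [← Real.sin_two_mul, mul_div_cancel₀ x two_ne_zero]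
    rwa [add_div, Real.cos_add_pi_div_two, Real.sin_add_pi, neg_mul_neg, hsin,
      show Real.sin (x / 2) * (2 * Real.sin (x / 2) * Real.cos (x / 2))
        = 2 * Real.sin (x / 2) ^ 2 * Real.cos (x / 2) by ring, abs_mul,
      abs_of_nonneg (by positivity : 0 ≤ 2 * Real.sin (x / 2) ^ 2)] at hb
  have h1 : ∫ x in (0 : ℝ)..Real.pi / 2, ‖symbol h (x + Real.pi)‖ * majorant x ≤ 22 / 25 := by
    calc _ ≤ ∫ x in (0 : ℝ)..Real.pi / 2,
          2 * Real.sin (x / 2) ^ 2 * Real.cos (x / 2) * majorant x := by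
          refine intervalIntegral.integral_mono_on (by positivity) (hi _ _)
            (hgc.intervalIntegrable _ _) fun x hx => ?_
          have := hedge x (Real.cos_nonneg_of_neg_pi_div_two_le_of_le
            (by linarith [hx.1]) hx.2)
          rwa [abs_of_nonneg (Real.cos_nonneg_of_neg_pi_div_two_le_of_le
            (by linarith [hx.1]) (by linarith [hx.1, hx.2]))] at this
      _ = edgePrimitive (Real.pi / 2) - edgePrimitive 0 :=
          intervalIntegral.integral_eq_sub_of_hasDerivAt (fun x _ => hasDerivAt_edgePrimitive x)
            (hgc.intervalIntegrable _ _)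
      _ ≤ 22 / 25 := by
          have := edgePrimitive_le (x := Real.pi / 2) (by
            rw [show Real.pi / 2 / 2 = Real.pi / 4 by ring, Real.sin_pi_div_four])
          simpa [edgePrimitive] using this
  have h3 : ∫ x in (3 * Real.pi / 2)..2 * Real.pi, ‖symbol h (x + Real.pi)‖ * majorant x
      ≤ 22 / 25 := by
    calc _ ≤ ∫ x in (3 * Real.pi / 2)..2 * Real.pi,
          -(2 * Real.sin (x / 2) ^ 2 * Real.cos (x / 2) * majorant x) := by
          refine intervalIntegral.integral_mono_on (by linarith) (hi _ _)
            (hgc.neg.intervalIntegrable _ _) fun x hx => ?_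
          have := hedge x (by
            rw [← Real.cos_sub_two_pi]
            exact Real.cos_nonneg_of_neg_pi_div_two_le_of_le
              (by linarith [hx.1]) (by linarith [hx.2]))
          rw [abs_of_nonpos (Real.cos_nonpos_of_pi_div_two_le_of_le
            (by linarith [hx.1]) (by linarith [hx.2]))] at this
          linarith
      _ = -(edgePrimitive (2 * Real.pi) - edgePrimitive (3 * Real.pi / 2)) := by
          rw [intervalIntegral.integral_neg, intervalIntegral.integral_eq_sub_of_hasDerivAt
            (fun x _ => hasDerivAt_edgePrimitive x) (hgc.intervalIntegrable _ _)]
      _ ≤ 22 / 25 := by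
          have := edgePrimitive_le (x := 3 * Real.pi / 2) (by
            rw [show 3 * Real.pi / 2 / 2 = Real.pi - Real.pi / 4 by ring, Real.sin_pi_sub,
              Real.sin_pi_div_four])
          have h0 : edgePrimitive (2 * Real.pi) = 0 := by
            simp [edgePrimitive]
          linarith
  have h2 : ∫ x in (Real.pi / 2)..(3 * Real.pi / 2), ‖symbol h (x + Real.pi)‖ * majorant x
      ≤ 101 / 40 * Real.pi + 19 / 6 := by
    rw [← integral_majorant]
    refine intervalIntegral.integral_mono_on (by linarith) (hi _ _)
      (hmc.intervalIntegrable _ _) fun x _ => ?_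
    exact mul_le_of_le_one_left (hu0 x) (hh.norm_symbol_le_one (by omega) _)
  rw [← intervalIntegral.integral_add_adjacent_intervals (hi 0 (Real.pi / 2)) (hi _ _),
    ← intervalIntegral.integral_add_adjacent_intervals (hi (Real.pi / 2) (3 * Real.pi / 2))
      (hi _ _)]
  linarith [Real.pi_gt_d2]

/-! ### Norms and constants -/

/-- The `L_p` bound in the normalization of the problem: the factor `√(2π)` in the hypothesis turns
into the power `(2π) ^ (1 / p - 1 / 2)`. -/
theorem memLp_and_toReal_eLpNorm_le {g : ℝ → ℂ} (hg : Continuous g) {p : ℝ} (hp : 1 < p)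
    {b : ℝ → ℝ} (hb : Integrable b) (hgb : ∀ x, (Real.sqrt (2 * Real.pi) * ‖g x‖) ^ p ≤ b x) :
    MemLp g (ENNReal.ofReal p) volume ∧ (eLpNorm g (ENNReal.ofReal p) volume).toReal
      ≤ (2 * Real.pi) ^ (1 / p - 1 / 2) * ((∫ x, b x) / (2 * Real.pi)) ^ (1 / p) := by
  have hp0 : 0 < p := by linarith
  have h2pi : 0 < 2 * Real.pi := by positivity
  have hpe : (ENNReal.ofReal p).toReal = p := ENNReal.toReal_ofReal hp0.le
  have hpne : ENNReal.ofReal p ≠ 0 := by simpa using hp0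
  have hle : ∀ x, ‖g x‖ ^ p ≤ (2 * Real.pi) ^ (-(p / 2)) * b x := by
    intro x
    have h1 := hgb x
    rw [Real.mul_rpow (Real.sqrt_nonneg _) (norm_nonneg _), Real.sqrt_eq_rpow,
      ← Real.rpow_mul h2pi.le] at h1
    calc ‖g x‖ ^ p = (2 * Real.pi) ^ (-(p / 2)) * ((2 * Real.pi) ^ (1 / 2 * p) * ‖g x‖ ^ p) := by
          rw [← mul_assoc, ← Real.rpow_add h2pi, show -(p / 2) + 1 / 2 * p = 0 by ring,
            Real.rpow_zero, one_mul]
      _ ≤ _ := by gcongr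
  have hbi : Integrable fun x => (2 * Real.pi) ^ (-(p / 2)) * b x := hb.const_mul _
  have hgi : Integrable fun x => ‖g x‖ ^ p := by
    refine hbi.mono' ((hg.norm.rpow_const fun _ => Or.inr hp0.le).aestronglyMeasurable)
      (Filter.Eventually.of_forall fun x => ?_)
    rw [Real.norm_of_nonneg (by positivity)]
    exact hle x
  have hmem : MemLp g (ENNReal.ofReal p) volume := by
    rw [← integrable_norm_rpow_iff hg.aestronglyMeasurable hpne ENNReal.ofReal_ne_top, hpe]
    exact hgi
  refine ⟨hmem, ?_⟩
  have hint : ∫ x, ‖g x‖ ^ p ≤ (2 * Real.pi) ^ (-(p / 2)) * ∫ x, b x := by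
    rw [← integral_const_mul]
    exact integral_mono hgi hbi hle
  have hI0 : 0 ≤ ∫ x, ‖g x‖ ^ p := integral_nonneg fun x => by positivity
  have hB0 : 0 ≤ ∫ x, b x := integral_nonneg fun x => le_trans (by positivity) (hgb x)
  rw [hmem.eLpNorm_eq_integral_rpow_norm hpne ENNReal.ofReal_ne_top, hpe,
    ENNReal.toReal_ofReal (by positivity)]
  calc (∫ x, ‖g x‖ ^ p) ^ p⁻¹ ≤ ((2 * Real.pi) ^ (-(p / 2)) * ∫ x, b x) ^ p⁻¹ := by gcongr
    _ = ((2 * Real.pi) ^ (1 - p / 2) * ((∫ x, b x) / (2 * Real.pi))) ^ p⁻¹ := by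
        rw [sub_eq_add_neg, Real.rpow_add h2pi, Real.rpow_one]
        congr 1
        field_simp
    _ = _ := by
        rw [Real.mul_rpow (by positivity) (by positivity), ← Real.rpow_mul h2pi.le, one_div]
        congr 2
        field_simp

theorem twelve_mul_four_pow_le_factorialRatio (n : ℕ) :
    12 * 4 ^ n ≤ factorialRatio (n + 2) := by
  induction n with
  | zero => norm_num [factorialRatio, Nat.factorial]
  | succ n ih =>
    have h : factorialRatio (n + 1 + 2)
        = factorialRatio (n + 2) * (2 * (2 * n + 5) / (n + 2)) := by
      unfold factorialRatio
      rw [show 2 * (n + 1 + 2) = (2 * (n + 2) + 1) + 1 by ring,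
        show n + 1 + 2 - 1 = n + 2 by omega, show n + 2 - 1 = n + 1 by omega,
        show n + 1 + 2 = (n + 2) + 1 by ring, Nat.factorial_succ (2 * (n + 2) + 1),
        Nat.factorial_succ (2 * (n + 2)), Nat.factorial_succ (n + 2), Nat.factorial_succ (n + 1)]
      have h1 : ((n + 1).factorial : ℝ) ≠ 0 := by positivity
      push_cast
      field_simp
      ring
    have h4 : (4 : ℝ) ≤ 2 * (2 * n + 5) / (n + 2) := by
      rw [le_div_iff₀ (by positivity)]
      linarith
    rw [h, pow_succ, ← mul_assoc]
    exact mul_le_mul ih h4 (by norm_num) (le_trans (by positivity) ih)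

/-- The middle term of `upperD` grows with `m`, at least like `(π / 2) ^ m`; here it is compared with
a multiple of `√(2π)` that it exceeds already at `m = 2`. The constant is `4.11 - 2`, with `4.11`
coming from `integral_norm_symbol_mul_majorant_le`. -/
theorem mul_sqrt_two_pi_le {m : ℕ} (hm : 2 ≤ m) :
    211 / 100 * (2 * Real.pi) ^ (1 / 2 : ℝ)
      ≤ (2 : ℝ) ^ (1 / 2 - 2 * (m : ℝ)) * Real.pi ^ ((m : ℝ) + 1 / 2)
        * factorialRatio m ^ (1 / 2 : ℝ) := by
  obtain ⟨n, rfl⟩ := Nat.exists_eq_add_of_le' hm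
  have hpi := Real.pi_pos
  have hr := twelve_mul_four_pow_le_factorialRatio n
  have hr0 : 0 ≤ factorialRatio (n + 2) := le_trans (by positivity) hr
  refine le_of_sq_le_sq ?_ (by positivity)
  have hsq : ∀ x : ℝ, 0 ≤ x → (x ^ (1 / 2 : ℝ)) ^ 2 = x := fun x hx => by
    rw [← Real.sqrt_eq_rpow, Real.sq_sqrt hx]
  have e1 : ((2 : ℝ) ^ (1 / 2 - 2 * ((n + 2 : ℕ) : ℝ))) ^ 2 = 2 / 16 ^ (n + 2) := by
    rw [← Real.rpow_natCast, ← Real.rpow_mul (by norm_num),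
      show (1 / 2 - 2 * ((n + 2 : ℕ) : ℝ)) * ((2 : ℕ) : ℝ) = 1 - ((4 * (n + 2) : ℕ) : ℝ) by
        push_cast; ring, Real.rpow_sub (by norm_num), Real.rpow_one, Real.rpow_natCast, pow_mul]
    norm_num
  have e2 : (Real.pi ^ (((n + 2 : ℕ) : ℝ) + 1 / 2)) ^ 2 = (Real.pi ^ 2) ^ (n + 2) * Real.pi := by
    rw [Real.rpow_add hpi, mul_pow, hsq _ hpi.le, Real.rpow_natCast]
    ring
  rw [mul_pow, mul_pow, mul_pow, hsq _ (by positivity), hsq _ hr0, e1, e2]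
  have h10 : (9.8 : ℝ) ≤ Real.pi ^ 2 := by nlinarith [Real.pi_gt_d2]
  calc (211 / 100) ^ 2 * (2 * Real.pi)
      ≤ 2 * Real.pi * (12 / 256 * ((9.8 : ℝ) ^ 2)) := by nlinarith
    _ ≤ 2 * Real.pi * (12 / 256 * (9.8 ^ 2 * (9.8 / 4) ^ n)) := by
        have : (1 : ℝ) ≤ (9.8 / 4) ^ n := one_le_pow₀ (by norm_num)
        gcongr
        exact le_mul_of_one_le_right (by positivity) this
    _ = 2 / 16 ^ (n + 2) * (9.8 ^ (n + 2) * Real.pi) * (12 * 4 ^ n) := by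
        rw [div_pow, pow_add, pow_add, show (16 : ℝ) ^ n = 4 ^ n * 4 ^ n by
          rw [← mul_pow]; norm_num]
        field_simp
        ring
    _ ≤ _ := by gcongr

/-- The last summand in the bracket of `lowerE` alone gives the first term after taking the
`p`-th root. -/
theorem lowerE_nonpos {p : ℝ} (hp : 1 < p) (m : ℕ) (c : ℝ) : lowerE p m c ≤ 0 := by
  have hr : 0 ≤ factorialRatio m := by unfold factorialRatio; positivity
  have h1 : (2 * Real.pi) ^ (1 / p - 1 / 2) = ((2 * Real.pi) ^ (1 - p / 2)) ^ (1 / p) := by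
    rw [← Real.rpow_mul (by positivity)]
    congr 1
    field_simp
  unfold lowerE
  rw [sub_nonpos, h1]
  refine Real.rpow_le_rpow (by positivity) ?_ (by positivity)
  have : 0 ≤ (2 : ℝ) ^ (-p * (1 / 2 + 2 * (m : ℝ)) + 1)
        * Real.pi ^ (p * ((m : ℝ) - 1 / 2) + 1) * factorialRatio m ^ (p / 2)
      + (2 * Real.pi) ^ (2 - c * p * Real.log m) := by positivity
  linarith

/-! ### The wavelet of order at least two -/

theorem IsScalingFunction.sqrt_mul_norm_fourier_le {m : ℕ} (hm : 1 ≤ m) {h : Fin (2 * m) → ℝ}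
    (hh : IsFilter m h) {φ : ℝ → ℂ} (hφ : IsScalingFunction h φ) (x : ℝ) (n : ℕ) :
    Real.sqrt (2 * Real.pi) * ‖fourier φ x‖
      ≤ ∏ l ∈ Finset.range n, ‖symbol h (x / 2 ^ (l + 1))‖ := by
  have h1 := hφ.norm_fourier_le hm hh x n
  have h0 : 0 < Real.sqrt (2 * Real.pi) := Real.sqrt_pos.mpr (by positivity)
  rwa [one_div, ← div_eq_inv_mul, le_div_iff₀ h0, mul_comm] at h1

theorem norm_fourier_wavelet {m : ℕ} {h : Fin (2 * m) → ℝ} {ψ φ : ℝ → ℂ}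
    (hψ : ∀ ω : ℝ, fourier ψ ω = Complex.exp (-(Complex.I * (ω : ℂ) / 2)) *
      (starRingEnd ℂ) (symbol h (ω / 2 + Real.pi)) * fourier φ (ω / 2)) (ω : ℝ) :
    Real.sqrt (2 * Real.pi) * ‖fourier ψ ω‖ = ‖symbol h (ω / 2 + Real.pi)‖ *
      (Real.sqrt (2 * Real.pi) * ‖fourier φ (ω / 2)‖) := by
  have : ‖Complex.exp (-(Complex.I * (ω : ℂ) / 2))‖ = 1 := by
    rw [Complex.norm_exp]
    simp
  rw [hψ, norm_mul, norm_mul, this, one_mul, RCLike.norm_conj]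
  ring

theorem memLp_and_upper_bound_of_two_le {m : ℕ} (hm : 2 ≤ m) {ψ : ℝ → ℂ} (hψ : IsWavelet m ψ)
    {p : ℝ} (hp : 1 < p) (c : ℝ) :
    MemLp (fourier ψ) (ENNReal.ofReal p) volume ∧
      (eLpNorm (fourier ψ) (ENNReal.ofReal p) volume).toReal ≤ upperD p m c := by
  obtain ⟨hψi, h, φ, hh, hφ, hψe⟩ := hψ
  set s : ℝ := Real.sqrt (2 * Real.pi) with hs
  have hs0 : 0 ≤ s := Real.sqrt_nonneg _
  have hGp : Function.Periodic (fun x => ‖symbol h x‖) (2 * Real.pi) := fun x => by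
    simp only [symbol_add_two_pi]
  obtain ⟨hint, hle⟩ := integrable_of_le_prod (G := fun x => ‖symbol h x‖)
    (f := fun x => ‖symbol h (x + Real.pi)‖) (u := majorant) (Φ := fun x => s * ‖fourier φ x‖)
    (continuous_symbol h).norm (fun _ => norm_nonneg _) hGp
    ((continuous_symbol h).comp (by fun_prop)).norm (fun _ => norm_nonneg _)
    (hGp.add_const _) continuous_majorant one_le_majorant majorant_add_two_pi
    (transfer_majorant_le hm hh)
    (continuous_const.mul (continuous_fourier hφ.integrable).norm) (fun _ => by positivity)
    fun x n => hφ.sqrt_mul_norm_fourier_le (by omega) hh x n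
  have hle' := hle.trans (integral_norm_symbol_mul_majorant_le hm hh)
  have heq : (fun ω => s * ‖fourier ψ ω‖)
      = fun ω => (fun x => ‖symbol h (x + Real.pi)‖ * (s * ‖fourier φ x‖)) (ω / 2) := by
    funext ω
    exact norm_fourier_wavelet hψe ω
  have hb : Integrable fun ω => s * ‖fourier ψ ω‖ := by
    rw [heq]
    exact hint.comp_div two_ne_zero
  have hbi : ∫ ω, s * ‖fourier ψ ω‖ ≤ 411 / 100 * (2 * Real.pi) := by
    rw [heq, Measure.integral_comp_div (fun x => ‖symbol h (x + Real.pi)‖ * (s * ‖fourier φ x‖)),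
      abs_of_pos two_pos, smul_eq_mul]
    linarith
  have hone : ∀ ω, s * ‖fourier ψ ω‖ ≤ 1 := by
    intro ω
    rw [hs, norm_fourier_wavelet hψe ω]
    have h1 := hφ.sqrt_mul_norm_fourier_le (by omega) hh (ω / 2) 0
    rw [Finset.prod_range_zero] at h1
    exact mul_le_one₀ (hh.norm_symbol_le_one (by omega) _) (by positivity) h1
  obtain ⟨hmem, hnorm⟩ := memLp_and_toReal_eLpNorm_le (continuous_fourier hψi) hp hb
    fun x => by
      have := Real.rpow_le_rpow_of_exponent_ge' (x := s * ‖fourier ψ x‖) (by positivity) (hone x)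
        zero_le_one hp.le
      rwa [Real.rpow_one] at this
  refine ⟨hmem, hnorm.trans ?_⟩
  have h0 : 0 ≤ (∫ ω, s * ‖fourier ψ ω‖) / (2 * Real.pi) :=
    div_nonneg (integral_nonneg fun _ => by positivity) (by positivity)
  have hp1 : 1 / p ≤ 1 := by rw [div_le_one (by linarith)]; exact hp.le
  -- As `4.11 ≥ 1`, taking the `p`-th root is harmless.
  have hK : ((∫ ω, s * ‖fourier ψ ω‖) / (2 * Real.pi)) ^ (1 / p) ≤ 411 / 100 := by
    calc _ ≤ (411 / 100 : ℝ) ^ (1 / p) := by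
          refine Real.rpow_le_rpow h0 ?_ (by positivity)
          rwa [div_le_iff₀ (by positivity)]
      _ ≤ (411 / 100 : ℝ) ^ (1 : ℝ) :=
          Real.rpow_le_rpow_of_exponent_le (by norm_num) hp1
      _ = _ := Real.rpow_one _
  have h2pi : 1 ≤ 2 * Real.pi := by linarith [Real.pi_gt_three]
  have hexp : (2 * Real.pi) ^ (1 / p - 1 / 2) ≤ (2 * Real.pi) ^ (1 / 2 : ℝ) :=
    Real.rpow_le_rpow_of_exponent_le h2pi (by linarith)
  have hA := mul_sqrt_two_pi_le hm
  have hlast : 0 ≤ (2 * Real.pi) ^ (2 - c * Real.log m) := by positivity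
  have hfirst : 0 ≤ (2 * Real.pi) ^ (1 / p - 1 / 2) := by positivity
  unfold upperD
  calc _ ≤ (2 * Real.pi) ^ (1 / p - 1 / 2) * (411 / 100) := by gcongr
    _ ≤ _ := by linarith

/-! ### The wavelet of order one -/

theorem norm_symbol_one {h : Fin (2 * 1) → ℝ} (hh : IsFilter 1 h) (x : ℝ) :
    ‖symbol h x‖ = |Real.cos (x / 2)| := by
  have h1 := hh.norm_sq x
  rw [show P 1 (Real.sin (x / 2) ^ 2) = 1 by simp [P], pow_one, mul_one] at h1
  rw [← abs_of_nonneg (norm_nonneg (symbol h x))]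
  exact (sq_eq_sq_iff_abs_eq_abs _ _).mp h1

/-- Viète's product, from repeated use of `sin (2 y) = 2 sin y cos y`. -/
theorem prod_abs_cos_mul (x : ℝ) (n : ℕ) :
    (∏ l ∈ Finset.range n, |Real.cos (x / 2 ^ (l + 1))|) * (2 ^ n * |Real.sin (x / 2 ^ n)|)
      = |Real.sin x| := by
  induction n with
  | zero => simp
  | succ n ih =>
    rw [← ih, Finset.prod_range_succ]
    have h1 : x / 2 ^ n = 2 * (x / 2 ^ (n + 1)) := by
      rw [pow_succ]; field_simp
    rw [h1, Real.sin_two_mul, abs_mul, abs_mul, abs_two, pow_succ]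
    ring

/-- Decay of Viète's product. Jordan's inequality `(2 / π) |y| ≤ |sin y|` at `y = x / 2 ^ n`, for a
large `n`, replaces the limit, at the cost of a factor `π / 2`. -/
theorem abs_mul_le_of_le_prod_abs_cos {x a : ℝ}
    (h : ∀ n, a ≤ ∏ l ∈ Finset.range n, |Real.cos (x / 2 ^ (l + 1))|) :
    |x| * a ≤ Real.pi / 2 := by
  obtain ⟨n, hn⟩ := pow_unbounded_of_one_lt |x| (one_lt_two (α := ℝ))
  have h2 : (0 : ℝ) < 2 ^ n := by positivity
  have hsmall : |x / 2 ^ n| ≤ Real.pi / 2 := by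
    rw [abs_div, abs_of_pos h2, div_le_iff₀ h2]
    nlinarith [Real.pi_gt_three]
  have h3 := Real.mul_abs_le_abs_sin hsmall
  rw [abs_div, abs_of_pos h2] at h3
  have h4 : 2 / Real.pi * |x| ≤ 2 ^ n * |Real.sin (x / 2 ^ n)| := by
    calc 2 / Real.pi * |x| = 2 ^ n * (2 / Real.pi * (|x| / 2 ^ n)) := by field_simp
      _ ≤ _ := by gcongr
  have h5 : a * (2 / Real.pi * |x|) ≤ 1 := by
    calc _ ≤ (∏ l ∈ Finset.range n, |Real.cos (x / 2 ^ (l + 1))|)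
          * (2 ^ n * |Real.sin (x / 2 ^ n)|) := by gcongr; exact h n
      _ = |Real.sin x| := prod_abs_cos_mul x n
      _ ≤ 1 := Real.abs_sin_le_one x
  calc |x| * a = Real.pi / 2 * (a * (2 / Real.pi * |x|)) := by field_simp
    _ ≤ Real.pi / 2 * 1 := by gcongr
    _ = _ := mul_one _

theorem norm_fourier_decay_of_eq_one {ψ : ℝ → ℂ} (hψ : IsWavelet 1 ψ) (ω : ℝ) :
    Real.sqrt (2 * Real.pi) * ‖fourier ψ ω‖ ≤ 1 ∧
      |ω| * (Real.sqrt (2 * Real.pi) * ‖fourier ψ ω‖) ≤ 2 * Real.pi := by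
  obtain ⟨-, h, φ, hh, hφ, hψe⟩ := hψ
  have hΦ := fun n => hφ.sqrt_mul_norm_fourier_le le_rfl hh (ω / 2) n
  have hH := hh.norm_symbol_le_one le_rfl (ω / 2 + Real.pi)
  have hle : Real.sqrt (2 * Real.pi) * ‖fourier ψ ω‖
      ≤ Real.sqrt (2 * Real.pi) * ‖fourier φ (ω / 2)‖ := by
    rw [norm_fourier_wavelet hψe ω]
    exact mul_le_of_le_one_left (by positivity) hH
  refine ⟨hle.trans (by simpa using hΦ 0), ?_⟩
  have h1 := abs_mul_le_of_le_prod_abs_cos (x := ω / 4)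
    (a := Real.sqrt (2 * Real.pi) * ‖fourier φ (ω / 2)‖) fun n => by
      refine (hΦ n).trans_eq (Finset.prod_congr rfl fun l _ => ?_)
      rw [norm_symbol_one hh]
      congr 2
      ring
  rw [abs_div, abs_of_pos (by norm_num : (0 : ℝ) < 4)] at h1
  have h2 := mul_le_mul_of_nonneg_left hle (abs_nonneg ω)
  linarith

theorem memLp_of_eq_one {ψ : ℝ → ℂ} (hψ : IsWavelet 1 ψ) {p : ℝ} (hp : 1 < p) :
    MemLp (fourier ψ) (ENNReal.ofReal p) volume := by
  have hb : Integrable fun ω : ℝ => (1 + 2 * Real.pi) ^ p * (1 + ‖ω‖) ^ (-p) :=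
    (integrable_one_add_norm (by simpa using hp)).const_mul _
  refine (memLp_and_toReal_eLpNorm_le (continuous_fourier hψ.1) hp hb fun ω => ?_).1
  obtain ⟨h1, h2⟩ := norm_fourier_decay_of_eq_one hψ ω
  have hpos : 0 < 1 + ‖ω‖ := by positivity
  rw [Real.rpow_neg hpos.le, ← div_eq_mul_inv, ← Real.div_rpow (by positivity) hpos.le]
  refine Real.rpow_le_rpow (by positivity) ?_ (by linarith)
  rw [le_div_iff₀ hpos, Real.norm_eq_abs]
  linarith

theorem upper_bound_of_eq_one {ψ : ℝ → ℂ} (hψ : IsWavelet 1 ψ) {p : ℝ} (hp : 2 ≤ p) (c : ℝ) :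
    (eLpNorm (fourier ψ) (ENNReal.ofReal p) volume).toReal ≤ upperD p 1 c := by
  have hpi := Real.pi_gt_three
  have hpi' := Real.pi_lt_d2
  -- `42` exceeds `1 + (2π)²`.
  have hb : Integrable fun ω : ℝ => 42 * (1 + ω ^ 2)⁻¹ := integrable_inv_one_add_sq.const_mul _
  have hle := (memLp_and_toReal_eLpNorm_le (continuous_fourier hψ.1) (one_lt_two.trans_le hp) hb
    fun ω => by
    obtain ⟨h1, h2⟩ := norm_fourier_decay_of_eq_one hψ ω
    refine (Real.rpow_le_rpow_of_exponent_ge' (by positivity) h1 zero_le_two hp).trans ?_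
    rw [Real.rpow_two, ← div_eq_mul_inv, le_div_iff₀ (by positivity), mul_add, mul_one,
      ← sq_abs ω, ← mul_pow, mul_comm (Real.sqrt _ * _) |ω|]
    have h3 := pow_le_one₀ (n := 2) (by positivity) h1
    have h4 := pow_le_pow_left₀ (by positivity) h2 2
    nlinarith).2
  rw [integral_const_mul, integral_univ_inv_one_add_sq,
    show 42 * Real.pi / (2 * Real.pi) = 21 by field_simp; norm_num] at hle
  refine hle.trans ?_
  have hp1 : 1 / p ≤ 1 / 2 := one_div_le_one_div_of_le two_pos hp
  have h1 : (2 * Real.pi) ^ (1 / p - 1 / 2) ≤ 1 :=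
    Real.rpow_le_one_of_one_le_of_nonpos (by linarith) (by linarith)
  have h2 : (21 : ℝ) ^ (1 / p) ≤ 21 := by
    calc _ ≤ (21 : ℝ) ^ (1 : ℝ) := Real.rpow_le_rpow_of_exponent_le (by norm_num) (by linarith)
      _ = 21 := Real.rpow_one _
  have hr : 0 ≤ factorialRatio 1 := by unfold factorialRatio; positivity
  unfold upperD
  have h3 : 0 ≤ 2 * (2 * Real.pi) ^ (1 / p - 1 / 2) := by positivity
  have h4 : 0 ≤ (2 : ℝ) ^ (1 / 2 - 2 * ((1 : ℕ) : ℝ)) * Real.pi ^ (((1 : ℕ) : ℝ) + 1 / 2)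
      * factorialRatio 1 ^ (1 / 2 : ℝ) := by positivity
  rw [Nat.cast_one, Real.log_one, mul_zero, sub_zero, Real.rpow_two]
  rw [Nat.cast_one] at h4
  calc _ ≤ (1 : ℝ) * 21 := by gcongr
    _ ≤ (2 * Real.pi) ^ 2 := by nlinarith
    _ ≤ _ := by linarith

end Daubechies
end

theorem corollary1 (m : ℕ) (hm : 1 ≤ m) (ψ : ℝ → ℂ) (hψ : Daubechies.IsWavelet m ψ)
    (p : ℝ) (hp : 1 < p) (c : ℝ) (hc : 0 < c) :
    MemLp (Daubechies.fourier ψ) (ENNReal.ofReal p) volume ∧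
    Daubechies.lowerE p m c ≤
      (eLpNorm (Daubechies.fourier ψ) (ENNReal.ofReal p) volume).toReal ∧
    ((2 ≤ m ∨ 2 ≤ p) →
      (eLpNorm (Daubechies.fourier ψ) (ENNReal.ofReal p) volume).toReal ≤
        Daubechies.upperD p m c) := by
  have hE := (Daubechies.lowerE_nonpos hp m c).trans
    (ENNReal.toReal_nonneg (a := eLpNorm (Daubechies.fourier ψ) (ENNReal.ofReal p) volume))
  rcases hm.eq_or_lt with rfl | hm2
  · exact ⟨Daubechies.memLp_of_eq_one hψ hp, hE, fun h =>
      Daubechies.upper_bound_of_eq_one hψ (h.resolve_left (by norm_num)) c⟩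
  · obtain ⟨hmem, hle⟩ := Daubechies.memLp_and_upper_bound_of_two_le hm2 hψ hp c
    exact ⟨hmem, hE, fun _ => hle⟩
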